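/- Let $A$ be a unital $C^*$-algebra and $\alpha:A\to A$ an injective unital $*$-endomorphism. A (contractive) covariant representation of $(A,\alpha)$ on a Hilbert space $H$ is a pair $(\pi,T)$ consisting of a $*$-representation $\pi:A\to B(H)$ and a contraction $T\in B(H)$ with $T\pi(\alpha(a))=\pi(a)T$ for all $a\in A$. Let $(\pi,T)$ be a contractive covariant representation of $(A,\alpha)$ on a Hilbert space $H$. Then there are a Hilbert space $K$ containing $H$ and a covariant representation $(\sigma,U)$ of $(A,\alpha)$ on $K$ such that $U$ is unitary, $\sigma(a)H\subseteq H$ and $\sigma(a)|_H=\pi(a)$ for all $a\in A$, and $$T^n=PU^n|_H\qquad\text{for all } n\ge 0,$$ where $P$ is the orthogonal projection of $K$ onto $H$. Moreover, $(\sigma,U)$ can be chosen as the minimal isometric dilation of a coisometric extension of $(\pi,T)$. That is, there are a closed subspace $L$ with $H\subseteq L\subseteq K$ and a covariant representation $(\rho,V)$ of $(A,\alpha)$ on $L$ such that: * $VV^*=I$, and for all $a\in A$ one has $\rho(a)H\subseteq H$, $\rho(a)|_H=\pi(a)$, $VH\subseteq H$, $V|_H=T$; * $\sigma(a)L\subseteq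 L$ and $\sigma(a)|_L=\rho(a)$ for all $a\in A$, $V^n=QU^n|_L$ for all $n\ge0$, where $Q$ is the orthogonal projection of $K$ onto $L$, and the smallest closed subspace of $K$ that contains $L$ and is invariant under $U$ is $K$. If $\pi$ is unital, then $\rho$ and $\sigma$ can be chosen unital as well. -/

import Mathlib

universe u v

namespace CStarDynamics

/-- A (contractive) covariant representation of the pair `(A, α)` on the Hilbert space `H`:
a representation `π` of `A` on `H` (a `*`-homomorphism into the bounded operators, not assumed
to preserve the unit) and a contraction `T` with `T π(α(a)) = π(a) T` for all `a`. -/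
structure CovariantRep {A : Type*} [CStarAlgebra A] (α : A →⋆ₐ[ℂ] A)
    (H : Type*) [NormedAddCommGroup H] [InnerProductSpace ℂ H] [CompleteSpace H] where
  /-- The representation of the algebra. -/
  rep : A →⋆ₙₐ[ℂ] (H →L[ℂ] H)
  /-- The contraction. -/
  op : H →L[ℂ] H
  norm_op_le : ‖op‖ ≤ 1
  covariant : ∀ a : A, op * rep (α a) = rep a * op

namespace CovariantRep

variable {A : Type*} [CStarAlgebra A] {α : A →⋆ₐ[ℂ] A}
variable {H : Type*} [NormedAddCommGroup H] [InnerProductSpace ℂ H] [CompleteSpace H]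
variable {K : Type*} [NormedAddCommGroup K] [InnerProductSpace ℂ K] [CompleteSpace K]

/-- `(π, T)` is isometric: `T* T = 1`. -/
def IsIsometric (R : CovariantRep α H) : Prop := star R.op * R.op = 1

/-- `(π, T)` is coisometric: `T T* = 1`. -/
def IsCoisometric (R : CovariantRep α H) : Prop := R.op * star R.op = 1

/-- `(π, T)` has unitary operator part: `T* T = 1` and `T T* = 1`. -/
def IsUnitary (R : CovariantRep α H) : Prop := R.op ∈ unitary (H →L[ℂ] H)

/-- The representation of the unital algebra `A` preserves the unit, i.e. is nondegenerate. -/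
def IsUnital (R : CovariantRep α H) : Prop := R.rep 1 = 1

/-- With `H` regarded as a subspace of `K` through the isometry `j`, the representation `S` on `K`
extends the representation `R` on `H`: both `S.rep a` and `S.op` map `H` into itself and restrict
there to `R.rep a` and `R.op`. -/
def Extends (S : CovariantRep α K) (R : CovariantRep α H) (j : H →ₗᵢ[ℂ] K) : Prop :=
  (∀ (a : A) (h : H), S.rep a (j h) = j (R.rep a h)) ∧ ∀ h : H, S.op (j h) = j (R.op h)

/-- With `H` regarded as a subspace of `K` through the isometry `j` (so that the adjoint of `j` is
the orthogonal projection of `K` onto `H`), the representation `S` on `K` dilates `R`: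
`S.rep a` maps `H` into itself and restricts there to `R.rep a`, and
`R.op ^ n = P S.op ^ n | H` for every `n ≥ 0`. -/
def Dilates (S : CovariantRep α K) (R : CovariantRep α H) (j : H →ₗᵢ[ℂ] K) : Prop :=
  (∀ (a : A) (h : H), S.rep a (j h) = j (R.rep a h)) ∧
    ∀ (n : ℕ) (h : H),
      (R.op ^ n) h = ContinuousLinearMap.adjoint j.toContinuousLinearMap ((S.op ^ n) (j h))

/-- `S` is a minimal isometric dilation of `R`: an isometric dilation such that the smallest closed
subspace of `K` that contains `H` and is invariant under `S.op` is `K` itself. -/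
def IsMinimalIsometricDilation (S : CovariantRep α K) (R : CovariantRep α H)
    (j : H →ₗᵢ[ℂ] K) : Prop :=
  S.IsIsometric ∧ S.Dilates R j ∧
    ∀ M : Submodule ℂ K, IsClosed (M : Set K) → (∀ h : H, j h ∈ M) →
      (∀ x ∈ M, S.op x ∈ M) → M = ⊤

end CovariantRep

end CStarDynamics

/-!
The dilation is built in two stages, each by one operator of lower triangular form
`(h, g) ↦ (C h, Y h + S g)` on an orthogonal sum `H ⊕ G` (`triangular`). Such an operator is
isometric as soon as `Y* Y = 1 - C* C` and `S` is an isometry with range orthogonal to that of `Y`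
(`star_triangular_mul_self`), and it intertwines sums of representations when its entries do.

*Coisometric extension.* The adjoint of the extension has this form with `C = T*`. Covariance
makes `T T*`, hence the defect operator `Δ = (1 - T T*) ^ (1/2)`, commute with `π`. What is needed
on `G` is a representation `τ` for which `τ ∘ α` contains orthogonal copies of `π` and of `τ`: if
`X : H → G` and `S : G → G` are the two intertwining isometries, then `Y = X Δ` and `S` are the
remaining entries. This is the one place where the injectivity of `α` enters
(`exists_absorbing_rep`). It rests on the fact that every positive functional on `A` has the form
`g ∘ α` with `g` positive (`exists_positive_extension`), which follows from the Hahn–Banach theorem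
because `α` is isometric and a functional attaining its norm at the unit is positive. Splitting `π`
into GNS representations (`exists_cyclic_decomposition`) and iterating this extension on the
functionals that occur yields `τ` as the sum of all the resulting GNS representations. A
representation that does not preserve the unit is made unital by passing to `A × ℂ`.

*Minimal isometric dilation.* For a coisometric pair `(ρ, V)` the projection `1 - V* V` onto
`ker V` commutes with `ρ (α a)`, so that `U (l, d₀, d₁, …) = (V l, (1 - V* V) l, d₀, d₁, …)` on
`L ⊕ ℓ²(ker V)` is covariant for `ρ ⊕ (ρ ∘ α) ⊕ (ρ ∘ α²) ⊕ ⋯`. It is a minimal isometric dilation,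
and it is onto since `V` is a coisometry: `(l, 0)` is the image of `V* l`, and `(0, d, 0, …)` with
`d ∈ ker V` is the image of `d` itself
(`CovariantRep.exists_unitary_minimal_dilation`).
-/

namespace CStarDynamics

open scoped ComplexOrder InnerProductSpace
open ContinuousLinearMap (adjoint)

/-! ### Extension of positive functionals -/

section Functionals

variable {A : Type*} [CStarAlgebra A] [PartialOrder A] [StarOrderedRing A]

/-- A bounded functional on a unital C⋆-algebra that attains its norm at the unit is positive. -/
theorem nonneg_of_norm_le_apply_one (f : A →L[ℂ] ℂ) {c : ℝ} (hc : ‖f‖ ≤ c) (h1 : f 1 = c)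
    {a : A} (ha : 0 ≤ a) : 0 ≤ f a := by
  have hc0 : 0 ≤ c := (norm_nonneg f).trans hc
  have hsa : IsSelfAdjoint a := .of_nonneg ha
  have bound (x : A) : ‖f x‖ ≤ c * ‖x‖ := (f.le_opNorm x).trans (by gcongr)
  rw [Complex.nonneg_iff]
  constructor
  · have hle : a ≤ algebraMap ℝ A ‖a‖ := hsa.le_algebraMap_norm_self
    have hn : ‖algebraMap ℝ A ‖a‖ - a‖ ≤ ‖a‖ := by
      refine CStarAlgebra.norm_le_iff_le_algebraMap _ (norm_nonneg a)
        (sub_nonneg.2 hle) |>.2 ?_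
      exact sub_le_self _ ha
    have h := (Complex.abs_re_le_norm _).trans ((bound _).trans (mul_le_mul_of_nonneg_left hn hc0))
    have e : f (algebraMap ℝ A ‖a‖ - a) = (‖a‖ : ℂ) * c - f a := by
      rw [map_sub, Algebra.algebraMap_eq_smul_one, ← Complex.coe_smul, map_smul, h1]; simp
    rw [e] at h
    have := (abs_le.1 h).2
    simp at this
    linarith
  · -- `‖f (a + it)‖² ≤ c² (‖a‖² + t²)` for all real `t`, which bounds `t ↦ 2 t c (im (f a))`
    have key (t : ℝ) : ((f a).im + t * c) ^ 2 ≤ c ^ 2 * (‖a‖ ^ 2 + t ^ 2) := by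
      set x : A := a + (Complex.I * t) • 1 with hx
      have hxx : star x * x = a * a + ((t : ℂ) ^ 2) • 1 := by
        have : star x = a - (Complex.I * t) • 1 := by
          simp [hx, hsa.star_eq, sub_eq_add_neg]
        rw [this, hx]
        simp only [sub_mul, mul_add, smul_sub, smul_mul_assoc, one_mul, mul_smul_comm, mul_one, smul_smul]
        rw [show Complex.I * t * (Complex.I * t) = -(t : ℂ) ^ 2 by
          linear_combination (t : ℂ) ^ 2 * Complex.I_mul_I]
        simp only [neg_smul]
        abel
      have hn : ‖x‖ ^ 2 ≤ ‖a‖ ^ 2 + t ^ 2 := by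
        rw [sq, ← CStarRing.norm_star_mul_self, hxx]
        refine (norm_add_le _ _).trans (add_le_add ((norm_mul_le _ _).trans (sq _).ge) ?_)
        rw [norm_smul]
        rcases subsingleton_or_nontrivial A with h | h
        · rw [Subsingleton.elim (1 : A) 0]; simp; positivity
        · simp
      have him : (f x).im = (f a).im + t * c := by
        rw [hx, map_add, map_smul, h1]; simp
      rw [← him]
      calc (f x).im ^ 2 ≤ ‖f x‖ ^ 2 := by
            rw [← sq_abs]; gcongr; exact Complex.abs_im_le_norm _
        _ ≤ (c * ‖x‖) ^ 2 := by gcongr; exact bound x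
        _ = c ^ 2 * ‖x‖ ^ 2 := by ring
        _ ≤ _ := by gcongr
    by_contra hne
    have hb : (f a).im ≠ 0 := fun h => hne h.symm
    have hc' : c ≠ 0 := by
      rintro rfl
      have := key 0
      simp at this
      exact hb this
    -- for this `t` the cross term `2 t c (im (f a))` equals `c² ‖a‖²`, leaving `(im (f a))² ≤ 0`
    have := key ((c ^ 2 * ‖a‖ ^ 2) / (2 * (f a).im * c))
    have e : ((f a).im * ((c ^ 2 * ‖a‖ ^ 2) / (2 * (f a).im * c)) * c) = c ^ 2 * ‖a‖ ^ 2 / 2 := by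
      field_simp
    have hpos : 0 < (f a).im ^ 2 := by positivity
    nlinarith

/-- The class of the unit in the GNS space, a cyclic vector implementing the functional. -/
noncomputable def gnsVector (f : A →ₚ[ℂ] ℂ) : f.GNS := ((f.toPreGNS 1 : f.PreGNS) : f.GNS)

theorem gnsStarAlgHom_apply_gnsVector (f : A →ₚ[ℂ] ℂ) (a : A) :
    f.gnsStarAlgHom a (gnsVector f) = ((f.toPreGNS a : f.PreGNS) : f.GNS) := by
  simp [gnsVector, PositiveLinearMap.gnsStarAlgHom]

theorem inner_gnsVector (f : A →ₚ[ℂ] ℂ) (a : A) :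
    ⟪gnsVector f, f.gnsStarAlgHom a (gnsVector f)⟫_ℂ = f a := by
  rw [gnsStarAlgHom_apply_gnsVector, gnsVector, UniformSpace.Completion.inner_coe,
    PositiveLinearMap.preGNS_inner_def]
  simp

/-- A positive functional attains its norm at the unit, being a vector functional of its GNS
representation. -/
theorem norm_apply_le_apply_one (f : A →ₚ[ℂ] ℂ) (a : A) : ‖f a‖ ≤ (f 1).re * ‖a‖ := by
  have h1 : (f 1).re = ‖gnsVector f‖ ^ 2 := by
    rw [← inner_gnsVector f 1, map_one, ← inner_self_eq_norm_sq (𝕜 := ℂ)]; rfl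
  rw [h1, ← inner_gnsVector f a]
  calc _ ≤ ‖gnsVector f‖ * (‖a‖ * ‖gnsVector f‖) := by
        refine (norm_inner_le_norm _ _).trans ?_
        gcongr
        refine (ContinuousLinearMap.le_opNorm _ _).trans ?_
        gcongr
        exact NonUnitalStarAlgHom.norm_apply_le _ _
    _ = _ := by ring

/-- Positive functionals extend along an injective unital endomorphism `α`: transport to the range
of `α`, extend with the same norm by the Hahn–Banach theorem, and note that the extension still
attains its norm at the unit. -/
theorem exists_positive_extension (α : A →⋆ₐ[ℂ] A) (hα : Function.Injective α) (f : A →ₚ[ℂ] ℂ) :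
    ∃ g : A →ₚ[ℂ] ℂ, ∀ a, g (α a) = f a := by
  let e := LinearEquiv.ofInjective (α : A →ₗ[ℂ] A) hα
  have hnorm (x : LinearMap.range (α : A →ₗ[ℂ] A)) : ‖e.symm x‖ = ‖x‖ := by
    obtain ⟨a, rfl⟩ := e.surjective x
    rw [e.symm_apply_apply]
    exact (NonUnitalStarAlgHom.norm_map α hα a).symm
  let φ : LinearMap.range (α : A →ₗ[ℂ] A) →L[ℂ] ℂ :=
    LinearMap.mkContinuous ((f : A →ₗ[ℂ] ℂ) ∘ₗ e.symm.toLinearMap) (f 1).re fun x => by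
      simpa [hnorm] using norm_apply_le_apply_one f (e.symm x)
  have hφ : ‖φ‖ ≤ (f 1).re := LinearMap.mkContinuous_norm_le _
    (Complex.nonneg_iff.1 (f.map_nonneg zero_le_one)).1 _
  obtain ⟨ψ, hψ, hψn⟩ := exists_extension_norm_eq _ φ
  have hψα (a : A) : ψ (α a) = f a := by
    have := hψ (e a)
    simp only [φ, LinearMap.mkContinuous_apply, LinearMap.comp_apply, LinearEquiv.coe_coe,
      e.symm_apply_apply] at this
    exact this
  refine ⟨PositiveLinearMap.mk₀ ψ.toLinearMap fun a ha => ?_, hψα⟩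
  refine nonneg_of_norm_le_apply_one ψ (hψn.trans_le hφ) ?_ ha
  have h1 : ψ 1 = f 1 := by rw [← hψα 1, map_one α]
  rw [h1]
  exact Complex.ext rfl (Complex.nonneg_iff.1 (f.map_nonneg zero_le_one)).2.symm

end Functionals

/-! ### Direct sums of representations -/

section DirectSum

variable {A : Type*} [CStarAlgebra A] {ι : Type*} {G : ι → Type*}
  [∀ i, NormedAddCommGroup (G i)] [∀ i, InnerProductSpace ℂ (G i)]

/-- The isometric inclusion of a summand in an `ℓ²`-sum. -/
noncomputable def lpIncl [DecidableEq ι] (i : ι) : G i →ₗᵢ[ℂ] lp G 2 where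
  toLinearMap := lp.lsingle 2 i
  norm_map' x := lp.norm_single (by norm_num) i x

@[simp]
theorem lpIncl_apply [DecidableEq ι] (i : ι) (x : G i) :
    lpIncl i x = lp.single 2 i x := rfl

variable [∀ i, CompleteSpace (G i)]

theorem norm_rep_apply_le {E : Type*} [NormedAddCommGroup E] [InnerProductSpace ℂ E]
    [CompleteSpace E] (π : A →⋆ₙₐ[ℂ] (E →L[ℂ] E)) (a : A) (x : E) : ‖π a x‖ ≤ ‖a‖ * ‖x‖ :=
  ((π a).le_opNorm x).trans <| by
    gcongr
    exact NonUnitalStarAlgHom.norm_apply_le π a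

theorem memℓp_directSum (π : ∀ i, A →⋆ₙₐ[ℂ] (G i →L[ℂ] G i)) (a : A) (x : lp G 2) :
    Memℓp (fun i => π i a (x i)) 2 :=
  ((lp.memℓp x).const_smul (‖a‖ : ℂ)).mono' fun i => by
    simpa [norm_smul] using norm_rep_apply_le (π i) a (x i)

/-- The Hilbert space direct sum of a family of representations, acting diagonally on the
`ℓ²`-sum of the spaces. -/
noncomputable def directSum (π : ∀ i, A →⋆ₙₐ[ℂ] (G i →L[ℂ] G i)) :
    A →⋆ₙₐ[ℂ] (lp G 2 →L[ℂ] lp G 2) where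
  toFun a := LinearMap.mkContinuous
    { toFun := fun x => ⟨fun i => π i a (x i), memℓp_directSum π a x⟩
      map_add' := fun x y => lp.ext (funext fun i => by simp; rfl)
      map_smul' := fun c x => lp.ext (funext fun i => by simp) } ‖a‖ fun x => by
    rw [← norm_norm a, ← Complex.norm_real ‖a‖, ← lp.norm_const_smul two_ne_zero]
    refine lp.norm_mono two_ne_zero fun i => ?_
    change ‖π i a (x i)‖ ≤ ‖(‖a‖ : ℂ) • x i‖
    simpa [norm_smul] using norm_rep_apply_le (π i) a (x i)
  map_smul' c a := by ext x i; simp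
  map_zero' := by ext x i; simp
  map_add' a b := by ext x i; simp; rfl
  map_mul' a b := by ext x i; simp
  map_star' a := by
    refine (ContinuousLinearMap.eq_adjoint_iff _ _).2 fun x y => ?_
    simp only [lp.inner_eq_tsum]
    congr 1
    ext i
    simp [map_star, ContinuousLinearMap.star_eq_adjoint, ContinuousLinearMap.adjoint_inner_left]

@[simp]
theorem directSum_apply (π : ∀ i, A →⋆ₙₐ[ℂ] (G i →L[ℂ] G i)) (a : A) (x : lp G 2) (i : ι) :
    directSum π a x i = π i a (x i) := rfl

theorem directSum_single [DecidableEq ι] (π : ∀ i, A →⋆ₙₐ[ℂ] (G i →L[ℂ] G i)) (a : A) (i : ι)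
    (x : G i) : directSum π a (lp.single 2 i x) = lp.single 2 i (π i a x) := by
  ext j
  rw [directSum_apply]
  by_cases h : j = i
  · subst h; simp
  · simp [h]

theorem directSum_one (π : ∀ i, A →⋆ₙₐ[ℂ] (G i →L[ℂ] G i)) (h : ∀ i, π i 1 = 1) :
    directSum π 1 = 1 := by
  ext x i
  simp [h]

/-- Isometries with pairwise orthogonal ranges that intertwine each summand with `σ` assemble to an
isometry intertwining the direct sum with `σ`. -/
theorem linearIsometry_directSum {E : Type*} [NormedAddCommGroup E] [InnerProductSpace ℂ E]
    [CompleteSpace E] (π : ∀ i, A →⋆ₙₐ[ℂ] (G i →L[ℂ] G i)) (σ : A →⋆ₙₐ[ℂ] (E →L[ℂ] E))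
    {V : ∀ i, G i →ₗᵢ[ℂ] E} (hV : OrthogonalFamily ℂ G V)
    (h : ∀ i a x, V i (π i a x) = σ a (V i x)) (a : A) (x : lp G 2) :
    hV.linearIsometry (directSum π a x) = σ a (hV.linearIsometry x) := by
  have h1 := hV.hasSum_linearIsometry (directSum π a x)
  simp only [directSum_apply, h] at h1
  exact h1.unique ((σ a).hasSum (hV.hasSum_linearIsometry x))

end DirectSum

/-! ### Cyclic decomposition and absorbing representations -/

section Cyclic

variable {A : Type u} [CStarAlgebra A] [PartialOrder A] [StarOrderedRing A]
  {E : Type*} [NormedAddCommGroup E] [InnerProductSpace ℂ E] [CompleteSpace E]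

/-- The positive functional `a ↦ ⟪ξ, σ a ξ⟫` given by a vector `ξ`. -/
noncomputable def vectorFunctional (σ : A →⋆ₙₐ[ℂ] (E →L[ℂ] E)) (ξ : E) : A →ₚ[ℂ] ℂ :=
  PositiveLinearMap.mk₀
    { toFun := fun a => ⟪ξ, σ a ξ⟫_ℂ
      map_add' := fun a b => by simp
      map_smul' := fun c a => by simp } fun a ha => by
    obtain ⟨b, rfl⟩ := CStarAlgebra.nonneg_iff_eq_star_mul_self.1 ha
    change 0 ≤ ⟪ξ, σ (star b * b) ξ⟫_ℂ
    rw [map_mul, map_star, ContinuousLinearMap.star_eq_adjoint, mul_apply_eq_comp,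
      ContinuousLinearMap.adjoint_inner_right]
    exact RCLike.nonneg_iff.2 ⟨inner_self_nonneg, inner_self_im _⟩

/-- The universal property of the GNS representation: a vector implementing `f` in a
representation `σ` induces an intertwining isometry from the GNS space of `f`. -/
theorem exists_gnsIsometry (f : A →ₚ[ℂ] ℂ) (σ : A →⋆ₙₐ[ℂ] (E →L[ℂ] E)) (ξ : E)
    (hf : ∀ a, ⟪ξ, σ a ξ⟫_ℂ = f a) :
    ∃ V : f.GNS →ₗᵢ[ℂ] E, (∀ a : A, V ((f.toPreGNS a : f.PreGNS) : f.GNS) = σ a ξ) ∧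
      ∀ a x, V (f.gnsNonUnitalStarAlgHom a x) = σ a (V x) := by
  let v₀ : f.PreGNS →ₗ[ℂ] E :=
    { toFun := fun x => σ (f.ofPreGNS x) ξ
      map_add' := fun x y => by simp
      map_smul' := fun c x => by simp }
  have hn (x : f.PreGNS) : ‖v₀ x‖ = ‖x‖ := by
    rw [← sq_eq_sq₀ (norm_nonneg _) (norm_nonneg _), ← Complex.ofReal_inj, Complex.ofReal_pow,
      Complex.ofReal_pow, f.preGNS_norm_sq, ← hf, map_mul, map_star,
      ContinuousLinearMap.star_eq_adjoint, mul_apply_eq_comp,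
      ContinuousLinearMap.adjoint_inner_right]
    exact (inner_self_eq_norm_sq_to_K (𝕜 := ℂ) (v₀ x)).symm
  let v : f.PreGNS →ₗᵢ[ℂ] E := ⟨v₀, hn⟩
  let V₀ : f.GNS →L[ℂ] E := v.toContinuousLinearMap.fromCompletion
  have hV₀ (x : f.PreGNS) : V₀ (x : f.GNS) = σ (f.ofPreGNS x) ξ :=
    ContinuousLinearMap.fromCompletion_apply_coe _ _
  have hVn (x : f.GNS) : ‖V₀ x‖ = ‖x‖ := by
    induction x using UniformSpace.Completion.induction_on with
    | hp => apply isClosed_eq <;> fun_prop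
    | ih x => rw [hV₀, UniformSpace.Completion.norm_coe]; exact hn x
  refine ⟨⟨V₀.toLinearMap, hVn⟩, fun a => hV₀ _, fun a x => ?_⟩
  change V₀ _ = σ a (V₀ x)
  induction x using UniformSpace.Completion.induction_on with
  | hp => apply isClosed_eq <;> fun_prop
  | ih x =>
    rw [PositiveLinearMap.gnsNonUnitalStarAlgHom_apply_coe, hV₀, hV₀]
    simp

/-- Every unital representation is a direct sum of GNS representations. A maximal set of vectors
generating pairwise orthogonal cyclic subspaces provides the summands. -/
theorem exists_cyclic_decomposition {H : Type v} [NormedAddCommGroup H] [InnerProductSpace ℂ H]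
    [CompleteSpace H] (π : A →⋆ₙₐ[ℂ] (H →L[ℂ] H)) (hπ : π 1 = 1) :
    ∃ (S : Set H) (f : S → A →ₚ[ℂ] ℂ) (Φ : lp (fun s => (f s).GNS) 2 ≃ₗᵢ[ℂ] H),
      ∀ a x, Φ (directSum (fun s => (f s).gnsNonUnitalStarAlgHom) a x) = π a (Φ x) := by
  classical
  have star_swap (s t : H) (a : A) : ⟪s, π a t⟫_ℂ = ⟪π (star a) s, t⟫_ℂ := by
    rw [map_star, ContinuousLinearMap.star_eq_adjoint, ContinuousLinearMap.adjoint_inner_left]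
  obtain ⟨S, hS⟩ := zorn_subset {S : Set H | S.Pairwise fun s t => ∀ a, ⟪s, π a t⟫_ℂ = 0}
    fun c hc hchain => ⟨⋃₀ c, (hchain.pairwise_sUnion).2 fun s hs => hc hs,
      fun s hs => Set.subset_sUnion_of_mem hs⟩
  let f : S → A →ₚ[ℂ] ℂ := fun s => vectorFunctional π s
  choose V hV hVπ using fun s : S => exists_gnsIsometry (f s) π s fun a => rfl
  have hort : OrthogonalFamily ℂ (fun s => (f s).GNS) V := by
    intro s t hst x y
    induction x, y using UniformSpace.Completion.induction_on₂ with
    | hp => apply isClosed_eq <;> fun_prop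
    | ih x y =>
      obtain ⟨a, rfl⟩ := (f s).toPreGNS.surjective x
      obtain ⟨b, rfl⟩ := (f t).toPreGNS.surjective y
      rw [hV, hV, ← star_star a, ← star_swap, ← mul_apply_eq_comp, ← map_mul]
      exact hS.prop s.2 t.2 (fun h => hst (Subtype.ext h)) _
  have hmem (s : S) (a : A) : π a s ∈ LinearMap.range hort.linearIsometry.toLinearMap :=
    ⟨lp.single 2 s (((f s).toPreGNS a : (f s).PreGNS) : (f s).GNS),
      (hort.linearIsometry_apply_single _).trans (hV s a)⟩
  have hclosed : IsClosed (LinearMap.range hort.linearIsometry.toLinearMap : Set H) :=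
    hort.linearIsometry.isometry.isClosedEmbedding.isClosed_range
  have hsurj : Function.Surjective hort.linearIsometry := by
    rw [← LinearIsometry.coe_toLinearMap, ← LinearMap.range_eq_top]
    have : CompleteSpace (LinearMap.range hort.linearIsometry.toLinearMap) :=
      hclosed.completeSpace_coe
    rw [← Submodule.orthogonal_eq_bot_iff, Submodule.eq_bot_iff]
    -- a vector orthogonal to all the summands can be added to `S`
    intro x hx
    have hxS : x ∈ S := by
      refine hS.le_of_ge (y := insert x S) ?_ (Set.subset_insert _ _) (Set.mem_insert _ _)
      refine hS.prop.insert fun t ht _ => ⟨fun a => ?_, fun a => ?_⟩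
      · exact Submodule.inner_left_of_mem_orthogonal (hmem ⟨t, ht⟩ a) hx
      · rw [star_swap]
        exact Submodule.inner_right_of_mem_orthogonal (hmem ⟨t, ht⟩ _) hx
    have := Submodule.inner_left_of_mem_orthogonal (hmem ⟨x, hxS⟩ 1) hx
    rw [hπ] at this
    exact inner_self_eq_zero.1 this
  exact ⟨S, f, LinearIsometryEquiv.ofSurjective hort.linearIsometry hsurj, fun a x =>
    linearIsometry_directSum _ _ hort hVπ a x⟩

end Cyclic

section Absorption

variable {A : Type u} [CStarAlgebra A]

/-- Pulling a representation back along an endomorphism. -/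
noncomputable def repComp {E : Type*} [NormedAddCommGroup E] [InnerProductSpace ℂ E] [CompleteSpace E]
    (τ : A →⋆ₙₐ[ℂ] (E →L[ℂ] E)) (α : A →⋆ₐ[ℂ] A) : A →⋆ₙₐ[ℂ] (E →L[ℂ] E) :=
  τ.comp (α : A →⋆ₙₐ[ℂ] A)

@[simp]
theorem repComp_apply {E : Type*} [NormedAddCommGroup E] [InnerProductSpace ℂ E] [CompleteSpace E]
    (τ : A →⋆ₙₐ[ℂ] (E →L[ℂ] E)) (α : A →⋆ₐ[ℂ] A) (a : A) : repComp τ α a = τ (α a) := rfl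

/-- The shift construction behind the absorbing representation: intertwining isometries
`F s → G (0, s) → G (1, s) → ⋯` assemble to isometries from `⨁ F` and from `⨁ G` into `⨁ G` with
orthogonal ranges. -/
theorem exists_shift (α : A →⋆ₐ[ℂ] A) {I : Type*} {F : I → Type*} {G : ℕ × I → Type*}
    [∀ s, NormedAddCommGroup (F s)] [∀ s, InnerProductSpace ℂ (F s)] [∀ s, CompleteSpace (F s)]
    [∀ p, NormedAddCommGroup (G p)] [∀ p, InnerProductSpace ℂ (G p)] [∀ p, CompleteSpace (G p)]
    (κ : ∀ s, A →⋆ₙₐ[ℂ] (F s →L[ℂ] F s)) (ρ : ∀ p, A →⋆ₙₐ[ℂ] (G p →L[ℂ] G p))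
    (J₀ : ∀ s, F s →ₗᵢ[ℂ] G (0, s)) (J : ∀ p : ℕ × I, G p →ₗᵢ[ℂ] G (p.1 + 1, p.2))
    (hJ₀ : ∀ s a x, J₀ s (κ s a x) = ρ (0, s) (α a) (J₀ s x))
    (hJ : ∀ p a x, J p (ρ p a x) = ρ (p.1 + 1, p.2) (α a) (J p x)) :
    ∃ (X : lp F 2 →ₗᵢ[ℂ] lp G 2) (S : lp G 2 →ₗᵢ[ℂ] lp G 2),
      (∀ a h, directSum ρ (α a) (X h) = X (directSum κ a h)) ∧
      (∀ a g, directSum ρ (α a) (S g) = S (directSum ρ a g)) ∧ ∀ h g, ⟪S g, X h⟫_ℂ = 0 := by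
  classical
  let W : ∀ p, G p →ₗᵢ[ℂ] lp G 2 := fun p => (lpIncl (p.1 + 1, p.2)).comp (J p)
  let W₀ : ∀ s, F s →ₗᵢ[ℂ] lp G 2 := fun s => (lpIncl (0, s)).comp (J₀ s)
  have hne {p q : ℕ × I} (h : p ≠ q) (x : G p) (y : G q) :
      ⟪lpIncl p x, lpIncl q y⟫_ℂ = 0 := by
    rw [lpIncl_apply, lp.inner_single_left, lpIncl_apply, lp.single_apply_ne _ _ _ h,
      inner_zero_right]
  have hW : OrthogonalFamily ℂ G W := fun p q hpq x y =>
    hne (fun h => hpq (by simpa [Prod.ext_iff] using h)) _ _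
  have hW₀ : OrthogonalFamily ℂ F W₀ := fun s t hst x y =>
    hne (fun h => hst (by simpa using h)) _ _
  have hWρ (p : ℕ × I) (a : A) (x : G p) :
      W p (ρ p a x) = repComp (directSum ρ) α a (W p x) := by
    change lp.single 2 _ (J p _) = directSum ρ (α a) (lp.single 2 _ (J p x))
    rw [hJ, directSum_single]
  have hW₀ρ (s : I) (a : A) (x : F s) :
      W₀ s (κ s a x) = repComp (directSum ρ) α a (W₀ s x) := by
    change lp.single 2 _ (J₀ s _) = directSum ρ (α a) (lp.single 2 _ (J₀ s x))
    rw [hJ₀, directSum_single]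
  refine ⟨hW₀.linearIsometry, hW.linearIsometry,
    fun a h => (linearIsometry_directSum _ _ hW₀ hW₀ρ a h).symm,
    fun a g => (linearIsometry_directSum _ _ hW hWρ a g).symm, fun h g => ?_⟩
  have h1 (p : ℕ × I) : ⟪W p (g p), hW₀.linearIsometry h⟫_ℂ = 0 :=
    ((innerSL ℂ (W p (g p))).hasSum (hW₀.hasSum_linearIsometry h)).unique <| by
      convert hasSum_zero with s
      exact hne (by simp) _ _
  rw [inner_eq_zero_symm]
  refine ((innerSL ℂ (hW₀.linearIsometry h)).hasSum (hW.hasSum_linearIsometry g)).unique ?_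
  convert hasSum_zero with p
  exact inner_eq_zero_symm.1 (h1 p)

/-- For every unital representation `π` there is a unital representation `τ` such that `τ ∘ α`
contains orthogonal copies of `π` (through `X`) and of `τ` itself (through `S`). Starting from the
functionals of a cyclic decomposition of `π`, iterated extension along `α` gives functionals
`f n s` with `f (n + 1) s ∘ α = f n s`; the sum of all their GNS representations is `τ`, and `S` is
the shift in `n`. -/
theorem exists_absorbing_rep (α : A →⋆ₐ[ℂ] A) (hα : Function.Injective α) {H : Type v}
    [NormedAddCommGroup H] [InnerProductSpace ℂ H] [CompleteSpace H]
    (π : A →⋆ₙₐ[ℂ] (H →L[ℂ] H)) (hπ : π 1 = 1) :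
    ∃ (G : Type (max u v)) (_ : NormedAddCommGroup G) (_ : InnerProductSpace ℂ G)
      (_ : CompleteSpace G) (τ : A →⋆ₙₐ[ℂ] (G →L[ℂ] G)) (X : H →ₗᵢ[ℂ] G) (S : G →ₗᵢ[ℂ] G),
      τ 1 = 1 ∧ (∀ a h, τ (α a) (X h) = X (π a h)) ∧ (∀ a g, τ (α a) (S g) = S (τ a g)) ∧
        ∀ h g, ⟪S g, X h⟫_ℂ = 0 := by
  classical
  let _ := CStarAlgebra.spectralOrder A
  have := CStarAlgebra.spectralOrderedRing A
  choose ext hext using exists_positive_extension α hα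
  obtain ⟨I, ω, Φ, hΦ⟩ := exists_cyclic_decomposition π hπ
  let f : ℕ → I → A →ₚ[ℂ] ℂ := fun n s => ext^[n + 1] (ω s)
  have hf (n : ℕ) (s : I) (a : A) : f (n + 1) s (α a) = f n s a := by
    simp only [f, Function.iterate_succ_apply' _ (n + 1), hext]
  have hf0 (s : I) (a : A) : f 0 s (α a) = ω s a := hext _ a
  have lift (g k : A →ₚ[ℂ] ℂ) (h : ∀ a, k (α a) = g a) : ∃ J : g.GNS →ₗᵢ[ℂ] k.GNS,
      ∀ a x, J (g.gnsNonUnitalStarAlgHom a x) = repComp k.gnsNonUnitalStarAlgHom α a (J x) := by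
    obtain ⟨J, -, hJ⟩ := exists_gnsIsometry g (repComp k.gnsNonUnitalStarAlgHom α) (gnsVector k)
      fun a => (inner_gnsVector k (α a)).trans (h a)
    exact ⟨J, hJ⟩
  choose J hJ using fun p : ℕ × I => lift (f p.1 p.2) (f (p.1 + 1) p.2) (hf p.1 p.2)
  choose J₀ hJ₀ using fun s : I => lift (ω s) (f 0 s) (hf0 s)
  obtain ⟨X, S, hX, hS, hXS⟩ := exists_shift α (fun s : I => (ω s).gnsNonUnitalStarAlgHom)
    (G := fun p : ℕ × I => (f p.1 p.2).GNS) (fun p => (f p.1 p.2).gnsNonUnitalStarAlgHom)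
    J₀ J hJ₀ hJ
  refine ⟨_, _, _, inferInstance, directSum fun p : ℕ × I => (f p.1 p.2).gnsNonUnitalStarAlgHom,
    X.comp Φ.symm.toLinearIsometry, S, directSum_one _ fun p => map_one (f p.1 p.2).gnsStarAlgHom,
    fun a h => ?_, hS, fun h g => hXS _ g⟩
  have h2 := hΦ a (Φ.symm h)
  rw [Φ.apply_symm_apply, ← Φ.eq_symm_apply] at h2
  exact (hX a (Φ.symm h)).trans (congrArg X h2)

/-- The absorbing representation of `exists_absorbing_rep` for a representation `π` that need not
preserve the unit. Such a `π` is the restriction to `A × 0` of the unital representation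
`(a, c) ↦ π a + c (1 - π 1)` of `A × ℂ`, to which `exists_absorbing_rep` applies with `α × id`. -/
theorem exists_absorbing_rep' (α : A →⋆ₐ[ℂ] A) (hα : Function.Injective α) {H : Type v}
    [NormedAddCommGroup H] [InnerProductSpace ℂ H] [CompleteSpace H]
    (π : A →⋆ₙₐ[ℂ] (H →L[ℂ] H)) :
    ∃ (G : Type (max u v)) (_ : NormedAddCommGroup G) (_ : InnerProductSpace ℂ G)
      (_ : CompleteSpace G) (τ : A →⋆ₙₐ[ℂ] (G →L[ℂ] G)) (X : H →ₗᵢ[ℂ] G) (S : G →ₗᵢ[ℂ] G),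
      (π 1 = 1 → τ 1 = 1) ∧ (∀ a h, τ (α a) (X h) = X (π a h)) ∧
        (∀ a g, τ (α a) (S g) = S (τ a g)) ∧ ∀ h g, ⟪S g, X h⟫_ℂ = 0 := by
  by_cases hπ : π 1 = 1
  · obtain ⟨G, _, _, _, τ, X, S, h1, h⟩ := exists_absorbing_rep α hα π hπ
    exact ⟨G, _, _, inferInstance, τ, X, S, fun _ => h1, h⟩
  have hl (a : A) : (1 - π 1) * π a = 0 := by rw [sub_mul, ← map_mul, one_mul, one_mul, sub_self]
  have hr (a : A) : π a * (1 - π 1) = 0 := by rw [mul_sub, ← map_mul, mul_one, mul_one, sub_self]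
  have hq : (1 - π 1) * (1 - π 1) = 1 - π 1 := by rw [mul_sub, hl, mul_one, sub_zero]
  have hs : star (1 - π 1) = 1 - π 1 := by rw [star_sub, star_one, ← map_star, star_one]
  let π' : A × ℂ →⋆ₙₐ[ℂ] (H →L[ℂ] H) :=
    { toFun := fun x => π x.1 + x.2 • (1 - π 1)
      map_smul' := fun c x => by simp [mul_smul]
      map_zero' := by simp
      map_add' := fun x y => by simp only [Prod.fst_add, Prod.snd_add, map_add, add_smul]; abel
      map_mul' := fun x y => by
        simp only [Prod.fst_mul, Prod.snd_mul, map_mul, mul_add, add_mul, smul_mul_assoc,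
          mul_smul_comm, hl, hr, hq, smul_zero, add_zero, zero_add, mul_comm x.2, mul_smul]
      map_star' := fun x => by simp [map_star, hs] }
  let α' : A × ℂ →⋆ₐ[ℂ] A × ℂ := (α.comp (StarAlgHom.fst ℂ A ℂ)).prod (StarAlgHom.snd ℂ A ℂ)
  have hα' : Function.Injective α' := fun x y h => by
    have h' : (α x.1, x.2) = (α y.1, y.2) := h
    exact Prod.ext (hα (Prod.ext_iff.1 h').1) (Prod.ext_iff.1 h').2
  obtain ⟨G, _, _, _, τ, X, S, -, hX, hS, hXS⟩ := exists_absorbing_rep α' hα' π' (by simp [π'])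
  refine ⟨G, _, _, inferInstance, τ.comp (NonUnitalStarAlgHom.inl ℂ A ℂ), X, S,
    fun h => (hπ h).elim, fun a h => ?_, fun a g => hS (a, 0) g, hXS⟩
  simpa [π', α'] using hX (a, 0) h

end Absorption

/-! ### Triangular operators on orthogonal sums -/

section OrthogonalSum

variable {A : Type*} [CStarAlgebra A]
  {H : Type*} [NormedAddCommGroup H] [InnerProductSpace ℂ H] [CompleteSpace H]
  {G : Type*} [NormedAddCommGroup G] [InnerProductSpace ℂ G] [CompleteSpace G]

theorem adjoint_linearIsometry_apply (V : H →ₗᵢ[ℂ] G) (x : H) :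
    adjoint V.toContinuousLinearMap (V x) = x :=
  ext_inner_right ℂ fun y => by
    rw [ContinuousLinearMap.adjoint_inner_left]
    exact V.inner_map_map x y

variable (H G) in
/-- The isometric inclusion of the first summand of an orthogonal sum. -/
noncomputable def sumInl : H →ₗᵢ[ℂ] WithLp 2 (H × G) where
  toFun h := WithLp.toLp 2 (h, 0)
  map_add' x y := by rw [← WithLp.toLp_add]; simp
  map_smul' c x := by rw [← WithLp.toLp_smul]; simp
  norm_map' x := by simp

variable (H G) in
/-- The isometric inclusion of the second summand of an orthogonal sum. -/
noncomputable def sumInr : G →ₗᵢ[ℂ] WithLp 2 (H × G) where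
  toFun g := WithLp.toLp 2 (0, g)
  map_add' x y := by rw [← WithLp.toLp_add]; simp
  map_smul' c x := by rw [← WithLp.toLp_smul]; simp
  norm_map' x := by simp

variable (H G) in
/-- The projection of an orthogonal sum to its first summand. -/
noncomputable def sumFst : WithLp 2 (H × G) →L[ℂ] H := adjoint (sumInl H G).toContinuousLinearMap

variable (H G) in
/-- The projection of an orthogonal sum to its second summand. -/
noncomputable def sumSnd : WithLp 2 (H × G) →L[ℂ] G := adjoint (sumInr H G).toContinuousLinearMap

@[simp]
theorem sumFst_sumInl (h : H) : sumFst H G (sumInl H G h) = h := adjoint_linearIsometry_apply _ h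

@[simp]
theorem sumSnd_sumInr (g : G) : sumSnd H G (sumInr H G g) = g := adjoint_linearIsometry_apply _ g

@[simp]
theorem sumFst_sumInr (g : G) : sumFst H G (sumInr H G g) = 0 :=
  ext_inner_right ℂ fun y => by
    rw [sumFst, ContinuousLinearMap.adjoint_inner_left]
    simp [sumInl, sumInr, WithLp.prod_inner_apply]

@[simp]
theorem sumSnd_sumInl (h : H) : sumSnd H G (sumInl H G h) = 0 :=
  ext_inner_right ℂ fun y => by
    rw [sumSnd, ContinuousLinearMap.adjoint_inner_left]
    simp [sumInl, sumInr, WithLp.prod_inner_apply]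

theorem sumInl_add_sumInr (x : WithLp 2 (H × G)) :
    sumInl H G (sumFst H G x) + sumInr H G (sumSnd H G x) = x := by
  obtain ⟨h, g, rfl⟩ : ∃ h g, x = sumInl H G h + sumInr H G g :=
    ⟨x.fst, x.snd, by
      change x = WithLp.toLp 2 (x.fst, 0) + WithLp.toLp 2 (0, x.snd)
      rw [← WithLp.toLp_add, Prod.mk_add_mk, add_zero, zero_add]
      rfl⟩
  simp

/-- The lower triangular operator `(h, g) ↦ (C h, Y h + S g)` on an orthogonal sum. -/
noncomputable def triangular (C : H →L[ℂ] H) (Y : H →L[ℂ] G) (S : G →L[ℂ] G) :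
    WithLp 2 (H × G) →L[ℂ] WithLp 2 (H × G) :=
  (sumInl H G).toContinuousLinearMap ∘L C ∘L sumFst H G +
    (sumInr H G).toContinuousLinearMap ∘L (Y ∘L sumFst H G + S ∘L sumSnd H G)

theorem triangular_apply (C : H →L[ℂ] H) (Y : H →L[ℂ] G) (S : G →L[ℂ] G) (x : WithLp 2 (H × G)) :
    triangular C Y S x =
      sumInl H G (C (sumFst H G x)) + sumInr H G (Y (sumFst H G x) + S (sumSnd H G x)) := rfl

theorem sumFst_triangular (C : H →L[ℂ] H) (Y : H →L[ℂ] G) (S : G →L[ℂ] G)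
    (x : WithLp 2 (H × G)) : sumFst H G (triangular C Y S x) = C (sumFst H G x) := by
  simp [triangular_apply]

theorem adjoint_triangular (C : H →L[ℂ] H) (Y : H →L[ℂ] G) (S : G →L[ℂ] G)
    (x : WithLp 2 (H × G)) :
    adjoint (triangular C Y S) x =
      sumInl H G (adjoint C (sumFst H G x) + adjoint Y (sumSnd H G x)) +
        sumInr H G (adjoint S (sumSnd H G x)) := by
  have h1 : adjoint (sumFst H G) = (sumInl H G).toContinuousLinearMap :=
    ContinuousLinearMap.adjoint_adjoint _
  have h2 : adjoint (sumSnd H G) = (sumInr H G).toContinuousLinearMap :=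
    ContinuousLinearMap.adjoint_adjoint _
  have h3 : adjoint (sumInl H G).toContinuousLinearMap = sumFst H G := rfl
  have h4 : adjoint (sumInr H G).toContinuousLinearMap = sumSnd H G := rfl
  simp only [triangular, map_add, ContinuousLinearMap.adjoint_comp, h1, h2, h3, h4,
    add_apply, ContinuousLinearMap.comp_apply,
    LinearIsometry.coe_toContinuousLinearMap]
  abel

/-- The triangular operator is isometric when `Y` is a square root of the defect `1 - C* C` and
`S` is an isometry with range orthogonal to that of `Y`. -/
theorem star_triangular_mul_self {C : H →L[ℂ] H} {Y : H →L[ℂ] G} {S : G →ₗᵢ[ℂ] G}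
    (hCY : ∀ h, adjoint C (C h) + adjoint Y (Y h) = h) (hSY : ∀ h g, ⟪S g, Y h⟫_ℂ = 0) :
    star (triangular C Y S.toContinuousLinearMap) * triangular C Y S.toContinuousLinearMap = 1 := by
  have h1 (h : H) : adjoint S.toContinuousLinearMap (Y h) = 0 :=
    ext_inner_left ℂ fun y => by
      rw [ContinuousLinearMap.adjoint_inner_right, inner_zero_right]
      exact hSY h y
  have h2 (g : G) : adjoint Y (S g) = 0 :=
    ext_inner_right ℂ fun y => by
      rw [ContinuousLinearMap.adjoint_inner_left, inner_zero_left, hSY]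
  ext x : 1
  rw [ContinuousLinearMap.star_eq_adjoint, mul_apply_eq_comp, adjoint_triangular, triangular_apply]
  simp only [map_add, sumFst_sumInl, sumFst_sumInr, sumSnd_sumInl, sumSnd_sumInr, add_zero,
    zero_add, LinearIsometry.coe_toContinuousLinearMap, h1, h2, adjoint_linearIsometry_apply]
  rw [← map_add, hCY, sumInl_add_sumInr]
  rfl

/-- The orthogonal sum of two representations. -/
noncomputable def sumRep (π : A →⋆ₙₐ[ℂ] (H →L[ℂ] H)) (τ : A →⋆ₙₐ[ℂ] (G →L[ℂ] G)) :
    A →⋆ₙₐ[ℂ] (WithLp 2 (H × G) →L[ℂ] WithLp 2 (H × G)) where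
  toFun a := triangular (π a) 0 (τ a)
  map_smul' c a := by ext x : 1; simp [triangular_apply]
  map_zero' := by ext x : 1; simp [triangular_apply]
  map_add' a b := by ext x : 1; simp [triangular_apply]; abel
  map_mul' a b := by ext x : 1; simp [triangular_apply]
  map_star' a := by
    ext x : 1
    rw [ContinuousLinearMap.star_eq_adjoint, adjoint_triangular]
    simp [triangular_apply, map_star, ContinuousLinearMap.star_eq_adjoint]

theorem sumRep_apply (π : A →⋆ₙₐ[ℂ] (H →L[ℂ] H)) (τ : A →⋆ₙₐ[ℂ] (G →L[ℂ] G)) (a : A)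
    (x : WithLp 2 (H × G)) :
    sumRep π τ a x = sumInl H G (π a (sumFst H G x)) + sumInr H G (τ a (sumSnd H G x)) := by
  change triangular (π a) 0 (τ a) x = _
  simp [triangular_apply]

theorem sumRep_sumInl (π : A →⋆ₙₐ[ℂ] (H →L[ℂ] H)) (τ : A →⋆ₙₐ[ℂ] (G →L[ℂ] G)) (a : A) (h : H) :
    sumRep π τ a (sumInl H G h) = sumInl H G (π a h) := by
  simp [sumRep_apply]

theorem sumRep_one {π : A →⋆ₙₐ[ℂ] (H →L[ℂ] H)} {τ : A →⋆ₙₐ[ℂ] (G →L[ℂ] G)} (hπ : π 1 = 1)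
    (hτ : τ 1 = 1) : sumRep π τ 1 = 1 := by
  ext x : 1
  simp [sumRep_apply, hπ, hτ, sumInl_add_sumInr]

/-- A triangular operator intertwines orthogonal sums of representations as soon as its entries
intertwine the summands. -/
theorem triangular_mul_sumRep {C : H →L[ℂ] H} {Y : H →L[ℂ] G} {S : G →L[ℂ] G}
    {π : A →⋆ₙₐ[ℂ] (H →L[ℂ] H)} {τ : A →⋆ₙₐ[ℂ] (G →L[ℂ] G)} {a b : A}
    (hC : ∀ h, C (π a h) = π b (C h)) (hY : ∀ h, Y (π a h) = τ b (Y h))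
    (hS : ∀ g, S (τ a g) = τ b (S g)) :
    triangular C Y S * sumRep π τ a = sumRep π τ b * triangular C Y S := by
  ext x : 1
  simp only [mul_apply_eq_comp, sumRep_apply, triangular_apply, map_add, sumFst_sumInl,
    sumFst_sumInr, sumSnd_sumInl, sumSnd_sumInr, map_zero, add_zero, zero_add, hC, hY, hS]
  abel

end OrthogonalSum

theorem norm_le_one_of_star_mul_self {E : Type*} [NormedAddCommGroup E] [InnerProductSpace ℂ E]
    [CompleteSpace E] {W : E →L[ℂ] E} (h : star W * W = 1) : ‖W‖ ≤ 1 := by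
  refine ContinuousLinearMap.opNorm_le_bound _ zero_le_one fun x => ?_
  rw [one_mul, ← sq_le_sq₀ (norm_nonneg _) (norm_nonneg _),
    ContinuousLinearMap.apply_norm_sq_eq_inner_adjoint_left]
  rw [ContinuousLinearMap.star_eq_adjoint] at h
  change RCLike.re ⟪(adjoint W * W) x, x⟫_ℂ ≤ _
  rw [h]
  exact (inner_self_eq_norm_sq (𝕜 := ℂ) x).le

/-! ### Coisometric extension -/

/-- Taking adjoints in the covariance relation. -/
theorem CovariantRep.adjoint_op_rep {A : Type*} [CStarAlgebra A] {α : A →⋆ₐ[ℂ] A}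
    {H : Type*} [NormedAddCommGroup H] [InnerProductSpace ℂ H] [CompleteSpace H]
    (R : CovariantRep α H) (a : A) : star R.op * R.rep a = R.rep (α a) * star R.op := by
  have := congrArg star (R.covariant (star a))
  simp only [star_mul, ← map_star, star_star] at this
  exact this.symm

/-- A coisometric extension on `H ⊕ G`, with `τ` on `G` absorbing `π`: the operator is the adjoint of
`W (h, g) = (T* h, X Δ h + S g)`, where `Δ` is the defect operator of `T*`. -/
theorem CovariantRep.exists_coisometric_extension {A : Type u} [CStarAlgebra A]
    (α : A →⋆ₐ[ℂ] A) (hα : Function.Injective α)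
    {H : Type v} [NormedAddCommGroup H] [InnerProductSpace ℂ H] [CompleteSpace H]
    (R : CovariantRep α H) :
    ∃ (L : Type (max u v)) (_ : NormedAddCommGroup L) (_ : InnerProductSpace ℂ L)
      (_ : CompleteSpace L) (i : H →ₗᵢ[ℂ] L) (E : CovariantRep α L),
      E.IsCoisometric ∧ E.Extends R i ∧ (R.IsUnital → E.IsUnital) := by
  obtain ⟨G, _, _, _, τ, X, S, h1, hX, hS, hXS⟩ := exists_absorbing_rep' α hα R.rep
  -- the defect operator of `T*`, which commutes with the representation
  have hpos : 0 ≤ 1 - R.op * star R.op := by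
    rw [sub_nonneg, ← CStarAlgebra.norm_le_one_iff_of_nonneg _ (mul_star_self_nonneg _),
      CStarRing.norm_self_mul_star]
    exact mul_le_one₀ R.norm_op_le (norm_nonneg _) R.norm_op_le
  obtain ⟨Δ, hΔ⟩ : ∃ Δ, Δ = CFC.sqrt (1 - R.op * star R.op) := ⟨_, rfl⟩
  have hΔsq : Δ * Δ = 1 - R.op * star R.op := by rw [hΔ, CFC.sqrt_mul_sqrt_self _ hpos]
  have hΔsa : star Δ = Δ := by rw [hΔ]; exact (CFC.sqrt_nonneg _).isSelfAdjoint
  have hcomm (a : A) : Commute (R.rep a) Δ := by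
    have : Commute (1 - R.op * star R.op) (R.rep a) := by
      refine (Commute.one_left _).sub_left ?_
      change R.op * star R.op * R.rep a = R.rep a * (R.op * star R.op)
      rw [mul_assoc, R.adjoint_op_rep, ← mul_assoc, R.covariant, mul_assoc]
    rw [hΔ, CFC.sqrt]
    exact (this.cfcₙ_nnreal _).symm
  let Y : H →L[ℂ] G := X.toContinuousLinearMap ∘L Δ
  have hY (h : H) : Y h = X (Δ h) := rfl
  have hYadj (h : H) : adjoint Y (Y h) = (1 - R.op * star R.op) h := by
    rw [← hΔsq, hY]
    simp only [Y, ContinuousLinearMap.adjoint_comp, ContinuousLinearMap.comp_apply,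
      adjoint_linearIsometry_apply]
    rw [← ContinuousLinearMap.star_eq_adjoint, hΔsa, mul_apply_eq_comp]
  let W := triangular (star R.op) Y S.toContinuousLinearMap
  have hW : star W * W = 1 := star_triangular_mul_self (fun h => by
    rw [hYadj, ← ContinuousLinearMap.star_eq_adjoint, star_star]
    simp) fun h g => hXS _ _
  have hWρ (a : A) : W * sumRep R.rep τ a = sumRep R.rep τ (α a) * W :=
    triangular_mul_sumRep (fun h => congr($(R.adjoint_op_rep a) h))
      (fun h => by rw [hY, hY, hX]; exact congrArg X congr($((hcomm a).eq.symm) h))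
      fun g => (hS a g).symm
  refine ⟨WithLp 2 (H × G), inferInstance, inferInstance, inferInstance, sumInl H G,
    { rep := sumRep R.rep τ
      op := star W
      norm_op_le := by rw [norm_star]; exact norm_le_one_of_star_mul_self hW
      covariant := fun a => ?_ }, ?_, ⟨fun a h => sumRep_sumInl _ _ _ _, fun h => ?_⟩,
      fun hR => sumRep_one hR (h1 hR)⟩
  · have := congrArg star (hWρ (star a))
    simp only [star_mul, ← map_star, star_star] at this
    exact this.symm
  · change star W * star (star W) = 1
    rw [star_star, hW]
  · change adjoint W (sumInl H G h) = _
    rw [adjoint_triangular]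
    simp [← ContinuousLinearMap.star_eq_adjoint]

/-! ### Minimal isometric dilation -/

section Compression

variable {A : Type*} [CStarAlgebra A]
  {E : Type*} [NormedAddCommGroup E] [InnerProductSpace ℂ E] [CompleteSpace E]

/-- The projection onto a closed invariant subspace commutes with a representation, since the
orthogonal complement is invariant too. -/
theorem orthogonalProjectionOnto_rep (π : A →⋆ₙₐ[ℂ] (E →L[ℂ] E)) (D : Submodule ℂ E)
    [CompleteSpace D] (hD : ∀ a, ∀ d ∈ D, π a d ∈ D) (a : A) (x : E) :
    (D.orthogonalProjectionOnto (π a x) : E) = π a (D.orthogonalProjectionOnto x) := by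
  refine (Submodule.eq_starProjection_of_mem_of_inner_eq_zero (hD a _ (Subtype.coe_prop _))
    fun w hw => ?_)
  rw [← map_sub, ← star_star a, map_star, ContinuousLinearMap.star_eq_adjoint,
    ContinuousLinearMap.adjoint_inner_left]
  exact Submodule.inner_left_of_mem_orthogonal (hD _ w hw)
    (Submodule.sub_starProjection_mem_orthogonal x)

/-- The restriction of a representation to a closed invariant subspace. -/
noncomputable def subrep (π : A →⋆ₙₐ[ℂ] (E →L[ℂ] E)) (D : Submodule ℂ E) [CompleteSpace D]
    (hD : ∀ a, ∀ d ∈ D, π a d ∈ D) : A →⋆ₙₐ[ℂ] (D →L[ℂ] D) where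
  toFun a := ((π a) ∘L D.subtypeL).codRestrict D fun d => hD a d d.2
  map_smul' c a := by ext d; simp; rfl
  map_zero' := by ext d; simp
  map_add' a b := by ext d; simp; rfl
  map_mul' a b := by ext d; simp; rfl
  map_star' a := by
    refine (ContinuousLinearMap.eq_adjoint_iff _ _).2 fun x y => ?_
    change ⟪π (star a) x, (y : E)⟫_ℂ = ⟪(x : E), π a y⟫_ℂ
    rw [map_star, ContinuousLinearMap.star_eq_adjoint, ContinuousLinearMap.adjoint_inner_left]

@[simp]
theorem subrep_apply_coe (π : A →⋆ₙₐ[ℂ] (E →L[ℂ] E)) (D : Submodule ℂ E) [CompleteSpace D]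
    (hD : ∀ a, ∀ d ∈ D, π a d ∈ D) (a : A) (d : D) : (subrep π D hD a d : E) = π a d := rfl

end Compression

section Shift

variable {D : Type*} [NormedAddCommGroup D] [InnerProductSpace ℂ D]

theorem orthogonalFamily_shift : OrthogonalFamily ℂ (fun _ : ℕ => D)
    fun n => lpIncl (G := fun _ : ℕ => D) (n + 1) := fun m n hmn x y => by
  change ⟪lp.single (E := fun _ : ℕ => D) 2 (m + 1) x,
    lp.single (E := fun _ : ℕ => D) 2 (n + 1) y⟫_ℂ = 0
  rw [lp.inner_single_left, lp.single_apply_ne _ _ _ (by simpa using hmn), inner_zero_right]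

variable [CompleteSpace D]

variable (D) in
/-- The unilateral shift on the `ℓ²`-sum of countably many copies of a Hilbert space. -/
noncomputable def shift : lp (fun _ : ℕ => D) 2 →ₗᵢ[ℂ] lp (fun _ : ℕ => D) 2 :=
  (orthogonalFamily_shift (D := D)).linearIsometry

theorem shift_single (n : ℕ) (d : D) :
    shift D (lp.single (E := fun _ : ℕ => D) 2 n d) =
      lp.single (E := fun _ : ℕ => D) 2 (n + 1) d :=
  orthogonalFamily_shift.linearIsometry_apply_single d

theorem inner_shift_single_zero (g : lp (fun _ : ℕ => D) 2) (d : D) :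
    ⟪shift D g, lp.single (E := fun _ : ℕ => D) 2 0 d⟫_ℂ = 0 := by
  rw [inner_eq_zero_symm]
  refine ((innerSL ℂ (lp.single (E := fun _ : ℕ => D) 2 0 d)).hasSum
    (orthogonalFamily_shift.hasSum_linearIsometry g)).unique ?_
  convert hasSum_zero with n
  change ⟪lp.single (E := fun _ : ℕ => D) 2 0 d,
    lp.single (E := fun _ : ℕ => D) 2 (n + 1) (g n)⟫_ℂ = 0
  rw [lp.inner_single_left, lp.single_apply_ne _ _ _ (by simp), inner_zero_right]

variable {A : Type*} [CStarAlgebra A]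

/-- The representation `β ⊕ (β ∘ α) ⊕ (β ∘ α²) ⊕ ⋯`. -/
noncomputable def orbitRep (α : A →⋆ₐ[ℂ] A) (β : A →⋆ₙₐ[ℂ] (D →L[ℂ] D)) :
    A →⋆ₙₐ[ℂ] (lp (fun _ : ℕ => D) 2 →L[ℂ] lp (fun _ : ℕ => D) 2) :=
  directSum fun n : ℕ => repComp β (α ^ n)

theorem orbitRep_single_zero (α : A →⋆ₐ[ℂ] A) (β : A →⋆ₙₐ[ℂ] (D →L[ℂ] D)) (a : A) (d : D) :
    orbitRep α β a (lp.single (E := fun _ : ℕ => D) 2 0 d) =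
      lp.single (E := fun _ : ℕ => D) 2 0 (β a d) :=
  directSum_single (G := fun _ : ℕ => D) (fun n => repComp β (α ^ n)) a 0 d

theorem shift_orbitRep (α : A →⋆ₐ[ℂ] A) (β : A →⋆ₙₐ[ℂ] (D →L[ℂ] D)) (a : A)
    (g : lp (fun _ : ℕ => D) 2) : shift D (orbitRep α β (α a) g) = orbitRep α β a (shift D g) := by
  have h : orbitRep α β (α a) = directSum (G := fun _ : ℕ => D)
      (fun n => repComp β (α ^ (n + 1))) a := by
    refine ContinuousLinearMap.ext fun g => lp.ext (funext fun n => ?_)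
    change β ((α ^ n) (α a)) (g n) = β ((α ^ (n + 1)) a) (g n)
    rw [pow_succ]
    rfl
  rw [h]
  exact
  linearIsometry_directSum (G := fun _ : ℕ => D) (fun n => repComp β (α ^ (n + 1)))
    (orbitRep α β) orthogonalFamily_shift
    (fun n a d => (directSum_single (G := fun _ : ℕ => D) (fun n => repComp β (α ^ n)) a
      (n + 1) d).symm) a g

end Shift

section DilationOperator

variable {L : Type*} [NormedAddCommGroup L] [InnerProductSpace ℂ L]
  {D : Type*} [NormedAddCommGroup D] [InnerProductSpace ℂ D]

/-- A map into a Hilbert space, followed by the inclusion of that space as the zeroth summand. -/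
noncomputable def zerothIncl (Q : L →L[ℂ] D) : L →L[ℂ] lp (fun _ : ℕ => D) 2 :=
  (lpIncl (G := fun _ : ℕ => D) 0).toContinuousLinearMap ∘L Q

theorem zerothIncl_apply (Q : L →L[ℂ] D) (l : L) :
    zerothIncl Q l = lp.single (E := fun _ : ℕ => D) 2 0 (Q l) := rfl

variable [CompleteSpace L] [CompleteSpace D]

theorem adjoint_zerothIncl (Q : L →L[ℂ] D) (l : L) :
    adjoint (zerothIncl Q) (zerothIncl Q l) = adjoint Q (Q l) := by
  rw [zerothIncl, ContinuousLinearMap.adjoint_comp]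
  exact congrArg (adjoint Q) (adjoint_linearIsometry_apply _ _)

/-- The operator `(l, d₀, d₁, …) ↦ (V l, Q l, d₀, d₁, …)` on `L ⊕ ℓ²(D)`. -/
noncomputable def dilationOp (V : L →L[ℂ] L) (Q : L →L[ℂ] D) :
    WithLp 2 (L × lp (fun _ : ℕ => D) 2) →L[ℂ] WithLp 2 (L × lp (fun _ : ℕ => D) 2) :=
  triangular V (zerothIncl Q) (shift D).toContinuousLinearMap

theorem dilationOp_sumInl (V : L →L[ℂ] L) (Q : L →L[ℂ] D) (l : L) :
    dilationOp V Q (sumInl L _ l) =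
      sumInl L _ (V l) + sumInr L _ (lp.single (E := fun _ : ℕ => D) 2 0 (Q l)) := by
  simp only [dilationOp, triangular_apply, sumFst_sumInl, sumSnd_sumInl, map_zero, add_zero,
    zerothIncl_apply]

theorem dilationOp_sumInr (V : L →L[ℂ] L) (Q : L →L[ℂ] D) (n : ℕ) (d : D) :
    dilationOp V Q (sumInr L _ (lp.single (E := fun _ : ℕ => D) 2 n d)) =
      sumInr L _ (lp.single (E := fun _ : ℕ => D) 2 (n + 1) d) := by
  simp only [dilationOp, triangular_apply, sumFst_sumInr, sumSnd_sumInr, map_zero, zero_add,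
    LinearIsometry.coe_toContinuousLinearMap, shift_single]

theorem sumFst_dilationOp_pow (V : L →L[ℂ] L) (Q : L →L[ℂ] D) (n : ℕ)
    (x : WithLp 2 (L × lp (fun _ : ℕ => D) 2)) :
    sumFst L _ ((dilationOp V Q ^ n) x) = (V ^ n) (sumFst L _ x) := by
  induction n with
  | zero => simp
  | succ n ih =>
    rw [pow_succ', pow_succ', mul_apply_eq_comp, mul_apply_eq_comp, ← ih]
    exact sumFst_triangular _ _ _ _

theorem star_dilationOp_mul_self {V : L →L[ℂ] L} {Q : L →L[ℂ] D}
    (hVQ : ∀ l, adjoint V (V l) + adjoint Q (Q l) = l) :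
    star (dilationOp V Q) * dilationOp V Q = 1 :=
  star_triangular_mul_self (fun l => by rw [adjoint_zerothIncl, hVQ])
    fun l g => inner_shift_single_zero g (Q l)

theorem eq_top_of_sumInl_mem_of_single_mem
    (M : Submodule ℂ (WithLp 2 (L × lp (fun _ : ℕ => D) 2)))
    (hM : IsClosed (M : Set (WithLp 2 (L × lp (fun _ : ℕ => D) 2))))
    (hl : ∀ l, sumInl L _ l ∈ M)
    (hr : ∀ n d, sumInr L _ (lp.single (E := fun _ : ℕ => D) 2 n d) ∈ M) : M = ⊤ := by
  refine eq_top_iff.2 fun x _ => ?_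
  rw [← sumInl_add_sumInr x]
  refine M.add_mem (hl _) ?_
  have hs := (lp.hasSum_single ENNReal.ofNat_ne_top (sumSnd L (lp (fun _ : ℕ => D) 2) x)).map
    (sumInr L (lp (fun _ : ℕ => D) 2)) (sumInr L _).continuous
  exact hM.mem_of_tendsto hs (.of_forall fun s => M.sum_mem fun n _ => hr n _)

/-- A closed subspace that contains `L` and is invariant under the dilation operator contains the
copies of `D` one after the other. -/
theorem eq_top_of_dilationOp_invariant {V : L →L[ℂ] L} {Q : L →L[ℂ] D}
    (hQ : Function.Surjective Q)
    (M : Submodule ℂ (WithLp 2 (L × lp (fun _ : ℕ => D) 2)))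
    (hM : IsClosed (M : Set (WithLp 2 (L × lp (fun _ : ℕ => D) 2))))
    (hl : ∀ l, sumInl L _ l ∈ M) (hU : ∀ x ∈ M, dilationOp V Q x ∈ M) : M = ⊤ := by
  refine eq_top_of_sumInl_mem_of_single_mem M hM hl fun n => ?_
  induction n with
  | zero =>
    intro d
    obtain ⟨l, rfl⟩ := hQ d
    have := hU _ (hl l)
    rw [dilationOp_sumInl] at this
    exact (M.add_mem_iff_right (hl _)).1 this
  | succ n ih => exact fun d => dilationOp_sumInr V Q n d ▸ hU _ (ih d)

/-- If `V` maps onto `L` vectors on which `Q` vanishes, and `Q` maps onto `D` vectors on which `V`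
vanishes, then the isometric dilation operator is onto, hence unitary. -/
theorem dilationOp_mul_star {V : L →L[ℂ] L} {Q : L →L[ℂ] D}
    (hVQ : ∀ l, adjoint V (V l) + adjoint Q (Q l) = l) (hV : ∀ l, ∃ m, V m = l ∧ Q m = 0)
    (hQ : ∀ d, ∃ m, Q m = d ∧ V m = 0) :
    dilationOp V Q * star (dilationOp V Q) = 1 := by
  have hU := star_dilationOp_mul_self hVQ
  have hiso : Isometry (dilationOp V Q) := AddMonoidHomClass.isometry_of_norm _ fun x => by
    rw [← sq_eq_sq₀ (norm_nonneg _) (norm_nonneg _),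
      ContinuousLinearMap.apply_norm_sq_eq_inner_adjoint_left,
      show (adjoint (dilationOp V Q) ∘L dilationOp V Q) x = x from congr($hU x)]
    exact inner_self_eq_norm_sq (𝕜 := ℂ) x
  have hrange : LinearMap.range (dilationOp V Q).toLinearMap = ⊤ := by
    refine eq_top_of_sumInl_mem_of_single_mem _ hiso.isClosedEmbedding.isClosed_range
      (fun l => ?_) fun n d => ?_
    · obtain ⟨m, hm, hm'⟩ := hV l
      refine ⟨sumInl L _ m, (dilationOp_sumInl V Q m).trans ?_⟩
      rw [hm, hm', lp.single_zero, map_zero, add_zero]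
    · cases n with
      | zero =>
        obtain ⟨m, hm, hm'⟩ := hQ d
        refine ⟨sumInl L _ m, (dilationOp_sumInl V Q m).trans ?_⟩
        rw [hm, hm', map_zero, zero_add]
      | succ n => exact ⟨_, dilationOp_sumInr V Q n d⟩
  ext x : 1
  obtain ⟨y, rfl⟩ : ∃ y, dilationOp V Q y = x := LinearMap.range_eq_top.1 hrange x
  change (dilationOp V Q * (star (dilationOp V Q) * dilationOp V Q)) y = dilationOp V Q y
  rw [hU, mul_one]

end DilationOperator

section Dilation

variable {A : Type*} [CStarAlgebra A] {α : A →⋆ₐ[ℂ] A}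
  {L : Type v} [NormedAddCommGroup L] [InnerProductSpace ℂ L] [CompleteSpace L]

/-- The minimal isometric dilation of a coisometric covariant representation `(ρ, V)` lives on
`L ⊕ ℓ²(ker V)`, where it is given by `U (l, d₀, d₁, …) = (V l, (1 - V* V) l, d₀, d₁, …)` and
`σ a = ρ a ⊕ ρ (α a) ⊕ ρ (α² a) ⊕ ⋯`. It is unitary because `V` is a coisometry. -/
theorem CovariantRep.exists_unitary_minimal_dilation (E : CovariantRep α L)
    (hE : E.IsCoisometric) :
    ∃ (K : Type v) (_ : NormedAddCommGroup K) (_ : InnerProductSpace ℂ K)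
      (_ : CompleteSpace K) (j : L →ₗᵢ[ℂ] K) (D : CovariantRep α K),
      D.IsMinimalIsometricDilation E j ∧ D.IsUnitary ∧ (E.IsUnital → D.IsUnital) := by
  have hVV (l : L) : E.op (adjoint E.op l) = l := congr($hE l)
  let D : Submodule ℂ L := LinearMap.ker E.op.toLinearMap
  have hDmem (l : L) : l ∈ D ↔ E.op l = 0 := LinearMap.mem_ker
  have : CompleteSpace D := E.op.isClosed_ker.completeSpace_coe
  -- `ker V` is invariant under `ρ ∘ α`, and the projection onto it is `1 - V* V`
  have hinv (a : A) (d : L) (hd : d ∈ D) : repComp E.rep α a d ∈ D := by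
    rw [hDmem] at hd ⊢
    have := congr($(E.covariant a) d)
    simpa [hd] using this
  let Q : L →L[ℂ] D := D.orthogonalProjectionOnto
  have hQ (l : L) : (Q l : L) = l - adjoint E.op (E.op l) := by
    refine (Submodule.eq_starProjection_of_mem_of_inner_eq_zero ?_ fun w hw => ?_)
    · rw [hDmem, map_sub, hVV, sub_self]
    · rw [sub_sub_cancel, ContinuousLinearMap.adjoint_inner_left, (hDmem w).1 hw,
        inner_zero_right]
  have hQD (d : D) : Q d = d := D.orthogonalProjectionOnto_mem_subspace_eq_self d
  have hVQ (l : L) : adjoint E.op (E.op l) + adjoint Q (Q l) = l := by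
    have : adjoint Q (Q l) = (Q l : L) := by rw [D.adjoint_orthogonalProjectionOnto]; rfl
    rw [this, hQ, add_sub_cancel]
  let β := subrep (repComp E.rep α) D hinv
  have hQβ (a : A) (l : L) :
      zerothIncl Q (E.rep (α a) l) = orbitRep α β a (zerothIncl Q l) := by
    rw [zerothIncl_apply, zerothIncl_apply, orbitRep_single_zero]
    exact congrArg _ (Subtype.ext (orthogonalProjectionOnto_rep (repComp E.rep α) D hinv a l))
  have hU : star (dilationOp E.op Q) * dilationOp E.op Q = 1 := star_dilationOp_mul_self hVQ
  have hU' : dilationOp E.op Q * star (dilationOp E.op Q) = 1 :=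
    dilationOp_mul_star hVQ
      (fun l => ⟨adjoint E.op l, hVV l, Subtype.ext ((hQ _).trans (by rw [hVV, sub_self]; rfl))⟩)
      fun d => ⟨d, hQD d, (hDmem d).1 d.2⟩
  refine ⟨WithLp 2 (L × lp (fun _ : ℕ => D) 2), inferInstance, inferInstance, inferInstance,
    sumInl L _,
    { rep := sumRep E.rep (orbitRep α β)
      op := dilationOp E.op Q
      norm_op_le := norm_le_one_of_star_mul_self hU
      covariant := fun a => triangular_mul_sumRep (fun l => congr($(E.covariant a) l)) (hQβ a)
        (shift_orbitRep α β a) },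
    ⟨hU, ⟨fun a l => sumRep_sumInl _ _ _ _, fun n l => ?_⟩,
      eq_top_of_dilationOp_invariant fun d => ⟨d, hQD d⟩⟩,
    Unitary.mem_iff.2 ⟨hU, hU'⟩, fun h1 => sumRep_one h1 (directSum_one _ fun n => ?_)⟩
  · exact ((sumFst_dilationOp_pow _ _ n _).trans (by rw [sumFst_sumInl])).symm
  · ext d
    have h1' : E.rep 1 = 1 := h1
    simp [β, h1']

/-- A dilation of an extension is a dilation. -/
theorem CovariantRep.Dilates.comp_extends
    {H : Type*} [NormedAddCommGroup H] [InnerProductSpace ℂ H] [CompleteSpace H]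
    {K : Type*} [NormedAddCommGroup K] [InnerProductSpace ℂ K] [CompleteSpace K]
    {D : CovariantRep α K} {E : CovariantRep α L} {R : CovariantRep α H}
    {j : L →ₗᵢ[ℂ] K} {i : H →ₗᵢ[ℂ] L} (hD : D.Dilates E j) (hE : E.Extends R i) :
    D.Dilates R (j.comp i) := by
  refine ⟨fun a h => ?_, fun n h => ?_⟩
  · change D.rep a (j (i h)) = j (i _)
    rw [hD.1, hE.1]
  · have hpow : (E.op ^ n) (i h) = i ((R.op ^ n) h) := by
      induction n with
      | zero => simp
      | succ n ih => rw [pow_succ', pow_succ', mul_apply_eq_comp, mul_apply_eq_comp, ih, hE.2]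
    have hadj : adjoint (j.comp i).toContinuousLinearMap =
        adjoint i.toContinuousLinearMap ∘L adjoint j.toContinuousLinearMap :=
      ContinuousLinearMap.adjoint_comp j.toContinuousLinearMap i.toContinuousLinearMap
    rw [hadj]
    change _ = adjoint i.toContinuousLinearMap (adjoint j.toContinuousLinearMap
      ((D.op ^ n) (j (i h))))
    rw [← hD.2, hpow, adjoint_linearIsometry_apply]

end Dilation

end CStarDynamics

theorem mainTheorem3 {A : Type u} [CStarAlgebra A] (α : A →⋆ₐ[ℂ] A) (hα : Function.Injective α)
    {H : Type v} [NormedAddCommGroup H] [InnerProductSpace ℂ H] [CompleteSpace H]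
    (R : CStarDynamics.CovariantRep α H) :
    ∃ (L : Type (max u v)) (_ : NormedAddCommGroup L) (_ : InnerProductSpace ℂ L)
      (_ : CompleteSpace L) (i : H →ₗᵢ[ℂ] L) (E : CStarDynamics.CovariantRep α L)
      (K : Type (max u v)) (_ : NormedAddCommGroup K) (_ : InnerProductSpace ℂ K)
      (_ : CompleteSpace K) (j : L →ₗᵢ[ℂ] K) (D : CStarDynamics.CovariantRep α K),
      -- `E` is a coisometric extension of `R`, and `D` is the minimal isometric dilation of `E`
      E.IsCoisometric ∧ E.Extends R i ∧ D.IsMinimalIsometricDilation E j ∧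
      -- `D` is a dilation of `R` with unitary operator part
      D.IsUnitary ∧ D.Dilates R (j.comp i) ∧
      -- nondegeneracy is preserved
      (R.IsUnital → E.IsUnital ∧ D.IsUnital) := by
  obtain ⟨L, _, _, _, i, E, hE, hER, hE1⟩ := R.exists_coisometric_extension α hα
  obtain ⟨K, _, _, _, j, D, hD, hDU, hD1⟩ := E.exists_unitary_minimal_dilation hE
  exact ⟨L, _, _, inferInstance, i, E, K, _, _, inferInstance, j, D, hE, hER, hD, hDU,
    hD.2.1.comp_extends hER, fun h => ⟨hE1 h, hD1 (hE1 h)⟩⟩
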